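/- For integers $t, n \ge 1$ and reals $0 \le r_1 \le r_2$, let ${\rm RAG}_t(n,[r_1,r_2])$ be the random graph on the vertices $1,\dots,n$ obtained by choosing $X_1,\dots,X_n$ independently and uniformly at random from the unit sphere $S^t = \{x \in \mathbb{R}^{t+1} : \|x\|_2 = 1\}$ and joining distinct vertices $i, j$ by an edge if and only if $r_1 \le \|X_i - X_j\|_2 \le r_2$. Put $$\psi(t) = \frac{\sqrt{\pi}\,(t+1)\,\Gamma\left(\frac{t+2}{2}\right)}{\Gamma\left(\frac{t+3}{2}\right)}.$$ Fix an integer $t \ge 1$ and real constants $a$ and $b \ge 0$. If $$a^t - b^t \ge \frac{8(t+1)\psi(t)}{1 - \frac{1}{2^{1+1/t}-1}} \quad\text{and}\quad a > 2^{1+\frac1t}\, b,$$ then the probability that ${\rm RAG}_t\left(n, \left[b\left(\frac{\log n}{n}\right)^{1/t}, a\left(\frac{\log n}{n}\right)^{1/t}\right]\right)$ is connected is $1-o(1)$ as $n \to \infty$. -/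

import Mathlib

open MeasureTheory Filter Topology

namespace RAG

/-- The `t`-dimensional unit sphere `S^t = {x ∈ ℝ^(t+1) | ‖x‖₂ = 1}`. -/
abbrev Sphere (t : ℕ) : Type :=
  Metric.sphere (0 : EuclideanSpace ℝ (Fin (t + 1))) 1

/-- The uniform probability distribution on `S^t`: the surface measure, normalised by its
total mass. -/
noncomputable def uniformSphere (t : ℕ) : Measure (Sphere t) :=
  ((volume : Measure (EuclideanSpace ℝ (Fin (t + 1)))).toSphere Set.univ)⁻¹ •
    (volume : Measure (EuclideanSpace ℝ (Fin (t + 1)))).toSphere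

instance (t : ℕ) : IsProbabilityMeasure (uniformSphere t) := by
  constructor
  have h0 : (volume : Measure (EuclideanSpace ℝ (Fin (t + 1)))).toSphere Set.univ ≠ 0 :=
    Measure.measure_univ_ne_zero.2 (Measure.toSphere_ne_zero _)
  rw [uniformSphere, Measure.smul_apply, smul_eq_mul]
  exact ENNReal.inv_mul_cancel h0 (measure_ne_top _ _)

/-- The annulus graph on the vertices `1, …, n`, placed at the points `X i` of `S^t`: distinct
vertices `i`, `j` are adjacent iff `r₁ ≤ ‖X i - X j‖₂ ≤ r₂`. -/
def annulusGraph {t n : ℕ} (X : Fin n → Sphere t) (r₁ r₂ : ℝ) : SimpleGraph (Fin n) where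
  Adj i j := i ≠ j ∧
    r₁ ≤ ‖(X i : EuclideanSpace ℝ (Fin (t + 1))) - X j‖ ∧
    ‖(X i : EuclideanSpace ℝ (Fin (t + 1))) - X j‖ ≤ r₂
  symm := ⟨fun i j h => by
    rw [norm_sub_rev]
    exact ⟨h.1.symm, h.2⟩⟩
  loopless := ⟨fun _ h => h.1 rfl⟩

/-- The joint law of the positions of the `n` vertices: independent and uniform on `S^t`. -/
noncomputable def positionLaw (t n : ℕ) : Measure (Fin n → Sphere t) :=
  Measure.pi fun _ => uniformSphere t

/-- The probability that the random annulus graph `RAG_t(n, [r₁, r₂])` is connected. -/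
noncomputable def probConnected (t n : ℕ) (r₁ r₂ : ℝ) : ENNReal :=
  positionLaw t n {X | (annulusGraph X r₁ r₂).Connected}

/-- The constant `ψ(t) = √π (t + 1) Γ((t + 2) / 2) / Γ((t + 3) / 2)`. -/
noncomputable def psi (t : ℕ) : ℝ :=
  Real.sqrt Real.pi * (t + 1) * Real.Gamma (((t : ℝ) + 2) / 2) /
    Real.Gamma (((t : ℝ) + 3) / 2)

end RAG

namespace RAG

open scoped Pointwise ENNReal RealInnerProductSpace

/-! Fix a pole `p` and write `l` for the scale `(log n / n)^(1/t)`. Connectivity follows from two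
events, each of probability tending to 1. Drift: every vertex at distance at least `K * l` from `p`
has a neighbour strictly closer to `p`. Density: every point within `(K + a) * l` of `p` has a
sample point within `ε * l`. A vertex of a component nearest to `p` then lies within `4 * ε * l` of
`p`, and any two such vertices have a common neighbour (`connected_annulusGraph`,
`reachable_of_near`).

Drift: in the tangent space at `x`, about half of the annulus points towards `p`. Since `psi t` is
the area of the sphere divided by the volume of the unit `t`-ball, this half has relative measure
about `(a^t - b^t) * l^t / (2 * psi t)`, which is at least about `4 * log n / n`. Curvature costs an
arbitrarily small proportion once `x` is far from `p` at scale `l`, so `2 * log n / n` remains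
(`exists_le_uniformSphere_closerNbhd`), and the union bound `n * (1 - 2 * log n / n)^(n-1)` tends to
0.

Density: boundedly many caps, each of measure at least a constant times `log n / n`, cover the
region near `p`; all are occupied with probability tending to 1. -/

/-! ### Surface measure through cones over the tangent hyperplane. -/

/-- The open truncated cone of height `h₀` over `W`, with apex at the origin. -/
def truncatedCone {t : ℕ} (W : Set (EuclideanSpace ℝ (Fin t))) (h₀ : ℝ) :
    Set (ℝ × EuclideanSpace ℝ (Fin t)) :=
  {p | 0 < p.1 ∧ p.1 < h₀ ∧ p.1⁻¹ • p.2 ∈ W}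

lemma measurableSet_truncatedCone {t : ℕ} {W : Set (EuclideanSpace ℝ (Fin t))}
    (hW : MeasurableSet W) (h₀ : ℝ) : MeasurableSet (truncatedCone W h₀) := by
  have h1 : MeasurableSet {p : ℝ × EuclideanSpace ℝ (Fin t) | 0 < p.1} :=
    measurableSet_lt measurable_const measurable_fst
  have h2 : MeasurableSet {p : ℝ × EuclideanSpace ℝ (Fin t) | p.1 < h₀} :=
    measurableSet_lt measurable_fst measurable_const
  have h3 : MeasurableSet {p : ℝ × EuclideanSpace ℝ (Fin t) | p.1⁻¹ • p.2 ∈ W} :=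
    (measurable_fst.inv.smul measurable_snd) hW
  exact h1.inter (h2.inter h3)

lemma volume_truncatedCone {t : ℕ} {W : Set (EuclideanSpace ℝ (Fin t))}
    (hW : MeasurableSet W) {h₀ : ℝ} (h₀_nonneg : 0 ≤ h₀) :
    volume (truncatedCone W h₀) = ENNReal.ofReal (h₀ ^ (t + 1) / (t + 1)) * volume W := by
  rw [Measure.volume_eq_prod, Measure.prod_apply (measurableSet_truncatedCone hW h₀)]
  have hslice : ∀ h : ℝ, volume (Prod.mk h ⁻¹' truncatedCone W h₀) =
      (Set.Ioo 0 h₀).indicator (fun h => ENNReal.ofReal (h ^ t) * volume W) h := by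
    intro h
    by_cases hh : h ∈ Set.Ioo 0 h₀
    · rw [Set.indicator_of_mem hh]
      have : Prod.mk h ⁻¹' truncatedCone W h₀ = h • W := by
        ext v
        rw [Set.mem_smul_set_iff_inv_smul_mem₀ hh.1.ne']
        simp [truncatedCone, hh.1, hh.2]
      rw [this, Measure.addHaar_smul, finrank_euclideanSpace, Fintype.card_fin,
        abs_of_nonneg (pow_nonneg hh.1.le _)]
    · rw [Set.indicator_of_notMem hh]
      have : Prod.mk h ⁻¹' truncatedCone W h₀ = ∅ := by
        ext v
        simp only [truncatedCone, Set.mem_preimage, Set.mem_ofPred_eq, Set.mem_empty_iff_false,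
          iff_false]
        exact fun hv => hh ⟨hv.1, hv.2.1⟩
      rw [this, measure_empty]
  simp_rw [hslice]
  rw [lintegral_indicator measurableSet_Ioo, lintegral_mul_const _ (by fun_prop),
    Measure.restrict_congr_set Ioo_ae_eq_Ioc,
    ← ofReal_integral_eq_lintegral_ofReal (intervalIntegral.intervalIntegrable_pow _).1,
    ← intervalIntegral.integral_of_le h₀_nonneg]
  · simp
  · filter_upwards [ae_restrict_mem measurableSet_Ioc] with y hy
    exact pow_nonneg hy.1.le _

/-- The coordinates of a vector in an orthonormal basis, the first one split off. -/
noncomputable def splitCoord {t : ℕ}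
    (b : OrthonormalBasis (Fin (t + 1)) ℝ (EuclideanSpace ℝ (Fin (t + 1))))
    (y : EuclideanSpace ℝ (Fin (t + 1))) : ℝ × EuclideanSpace ℝ (Fin t) :=
  (b.repr y 0, WithLp.toLp 2 fun i => b.repr y i.succ)

lemma measurePreserving_splitCoord {t : ℕ}
    (b : OrthonormalBasis (Fin (t + 1)) ℝ (EuclideanSpace ℝ (Fin (t + 1)))) :
    MeasurePreserving (splitCoord b) volume volume := by
  have h1 := b.measurePreserving_repr
  have h2 := PiLp.volume_preserving_ofLp (Fin (t + 1))
  have h3 := volume_preserving_piFinSuccAbove (fun _ : Fin (t + 1) => ℝ) 0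
  have h4 := (MeasurePreserving.id (volume : Measure ℝ)).prod (PiLp.volume_preserving_toLp (Fin t))
  exact h4.comp (h3.comp (h2.comp h1))

/-- The point of the tangent space at `b 0`, lifted to the hyperplane through `b 0`. -/
noncomputable def tangentPoint {t : ℕ}
    (b : OrthonormalBasis (Fin (t + 1)) ℝ (EuclideanSpace ℝ (Fin (t + 1))))
    (w : EuclideanSpace ℝ (Fin t)) : EuclideanSpace ℝ (Fin (t + 1)) :=
  b 0 + ∑ i, w i • b i.succ

lemma inner_basis_tangentPoint_zero {t : ℕ}
    (b : OrthonormalBasis (Fin (t + 1)) ℝ (EuclideanSpace ℝ (Fin (t + 1))))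
    (w : EuclideanSpace ℝ (Fin t)) : ⟪b 0, tangentPoint b w⟫ = 1 := by
  have h : ∀ i : Fin t, ⟪b 0, b i.succ⟫ = 0 := fun i => b.orthonormal.2 (Fin.succ_ne_zero i).symm
  simp [tangentPoint, inner_add_right, inner_sum, inner_smul_right, h]

lemma inner_basis_tangentPoint_succ {t : ℕ}
    (b : OrthonormalBasis (Fin (t + 1)) ℝ (EuclideanSpace ℝ (Fin (t + 1))))
    (w : EuclideanSpace ℝ (Fin t)) (j : Fin t) : ⟪b j.succ, tangentPoint b w⟫ = w j := by
  have h : ⟪b j.succ, b 0⟫ = 0 := b.orthonormal.2 (Fin.succ_ne_zero j)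
  have h' : ∀ i : Fin t, ⟪b j.succ, b i.succ⟫ = if j = i then 1 else 0 := fun i => by
    rw [orthonormal_iff_ite.1 b.orthonormal]
    simp
  simp [tangentPoint, inner_add_right, inner_sum, inner_smul_right, h, h']

lemma norm_tangentPoint_sq {t : ℕ}
    (b : OrthonormalBasis (Fin (t + 1)) ℝ (EuclideanSpace ℝ (Fin (t + 1))))
    (w : EuclideanSpace ℝ (Fin t)) : ‖tangentPoint b w‖ ^ 2 = 1 + ‖w‖ ^ 2 := by
  rw [← b.sum_sq_norm_inner_right, Fin.sum_univ_succ, inner_basis_tangentPoint_zero,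
    EuclideanSpace.norm_sq_eq]
  simp_rw [inner_basis_tangentPoint_succ]
  simp

lemma norm_tangentPoint {t : ℕ}
    (b : OrthonormalBasis (Fin (t + 1)) ℝ (EuclideanSpace ℝ (Fin (t + 1))))
    (w : EuclideanSpace ℝ (Fin t)) : ‖tangentPoint b w‖ = √(1 + ‖w‖ ^ 2) := by
  rw [← norm_tangentPoint_sq b w, Real.sqrt_sq (norm_nonneg _)]

lemma eq_smul_tangentPoint {t : ℕ}
    (b : OrthonormalBasis (Fin (t + 1)) ℝ (EuclideanSpace ℝ (Fin (t + 1))))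
    (y : EuclideanSpace ℝ (Fin (t + 1))) (hy : (splitCoord b y).1 ≠ 0) :
    y = (splitCoord b y).1 • tangentPoint b ((splitCoord b y).1⁻¹ • (splitCoord b y).2) := by
  set h := (splitCoord b y).1 with hh
  have hsum := b.sum_repr y
  rw [Fin.sum_univ_succ] at hsum
  conv_lhs => rw [← hsum]
  rw [tangentPoint, smul_add, Finset.smul_sum]
  congr 1
  refine Finset.sum_congr rfl fun i _ => ?_
  rw [smul_smul]
  congr 1
  simp [splitCoord, mul_inv_cancel_left₀ hy]

/-- Central projection from the tangent hyperplane at `b 0` shrinks volumes by at most the factor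
`(1 + ρ²)^((t + 1) / 2)` on the ball of radius `ρ`. -/
lemma le_toSphere_of_tangent {t : ℕ}
    (b : OrthonormalBasis (Fin (t + 1)) ℝ (EuclideanSpace ℝ (Fin (t + 1))))
    {W : Set (EuclideanSpace ℝ (Fin t))} (hW : MeasurableSet W) {ρ : ℝ}
    (hρ : ∀ w ∈ W, ‖w‖ ≤ ρ) {A : Set (Sphere t)} (hA : MeasurableSet A)
    (hWA : ∀ w ∈ W, ∀ y : Sphere t,
      (y : EuclideanSpace ℝ (Fin (t + 1))) = (√(1 + ‖w‖ ^ 2))⁻¹ • tangentPoint b w → y ∈ A) :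
    ENNReal.ofReal ((√(1 + ρ ^ 2))⁻¹ ^ (t + 1)) * volume W ≤
      (volume : Measure (EuclideanSpace ℝ (Fin (t + 1)))).toSphere A := by
  -- `toSphere A` is `t + 1` times the volume of the solid cone over `A`. At this height, every
  -- point of the flat cone over `W` has norm below 1, so it lies in that solid cone.
  have hsub : splitCoord b ⁻¹' truncatedCone W (√(1 + ρ ^ 2))⁻¹ ⊆
      Set.Ioo (0 : ℝ) 1 • (Subtype.val '' A) := by
    rintro y ⟨h1, h2, h3⟩
    set w := (splitCoord b y).1⁻¹ • (splitCoord b y).2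
    set h := (splitCoord b y).1
    have hs : 0 < √(1 + ‖w‖ ^ 2) := by positivity
    have hle : √(1 + ‖w‖ ^ 2) ≤ √(1 + ρ ^ 2) := by
      gcongr
      exact hρ w h3
    have hy : y = h • tangentPoint b w := eq_smul_tangentPoint b y h1.ne'
    have hu : ‖(√(1 + ‖w‖ ^ 2))⁻¹ • tangentPoint b w‖ = 1 := by
      rw [norm_smul, norm_tangentPoint, norm_inv, Real.norm_of_nonneg hs.le,
        inv_mul_cancel₀ hs.ne']
    refine Set.mem_smul.2 ⟨h * √(1 + ‖w‖ ^ 2), ⟨by positivity, ?_⟩,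
      (√(1 + ‖w‖ ^ 2))⁻¹ • tangentPoint b w, ⟨⟨_, by simpa using hu⟩, hWA w h3 _ rfl, rfl⟩, ?_⟩
    · calc h * √(1 + ‖w‖ ^ 2) < (√(1 + ρ ^ 2))⁻¹ * √(1 + ‖w‖ ^ 2) := by gcongr
        _ ≤ (√(1 + ρ ^ 2))⁻¹ * √(1 + ρ ^ 2) := by gcongr
        _ = 1 := inv_mul_cancel₀ (by positivity)
    · rw [smul_smul, mul_assoc, mul_inv_cancel₀ hs.ne', mul_one, ← hy]
  rw [Measure.toSphere_apply' _ hA, finrank_euclideanSpace, Fintype.card_fin]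
  refine le_trans (le_of_eq ?_) (mul_le_mul_right (measure_mono hsub) _)
  rw [(measurePreserving_splitCoord b).measure_preimage
    (measurableSet_truncatedCone hW _).nullMeasurableSet,
    volume_truncatedCone hW (by positivity), ← mul_assoc]
  congr 1
  rw [← ENNReal.ofReal_natCast, ← ENNReal.ofReal_mul (by positivity)]
  congr 1
  push_cast
  field_simp

lemma psi_pos (t : ℕ) : 0 < psi t := by
  have h1 : 0 < Real.Gamma (((t : ℝ) + 2) / 2) := Real.Gamma_pos_of_pos (by positivity)
  have h2 : 0 < Real.Gamma (((t : ℝ) + 3) / 2) := Real.Gamma_pos_of_pos (by positivity)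
  have h3 : 0 < √Real.pi := Real.sqrt_pos.2 Real.pi_pos
  unfold psi
  positivity

/-- Identifies `psi t` as the factor that converts volumes relative to the unit `t`-ball into
probabilities on the sphere. -/
lemma toSphere_univ_eq_psi {t : ℕ} (ht : 1 ≤ t) :
    (volume : Measure (EuclideanSpace ℝ (Fin (t + 1)))).toSphere Set.univ =
      ENNReal.ofReal (psi t) * volume (Metric.ball (0 : EuclideanSpace ℝ (Fin t)) 1) := by
  have : Nonempty (Fin t) := ⟨⟨0, ht⟩⟩
  rw [Measure.toSphere_apply_univ, EuclideanSpace.volume_ball, EuclideanSpace.volume_ball,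
    finrank_euclideanSpace, Fintype.card_fin, Fintype.card_fin, ENNReal.ofReal_one, one_pow,
    one_pow, one_mul, one_mul, ← ENNReal.ofReal_natCast, ← ENNReal.ofReal_mul (by positivity),
    ← ENNReal.ofReal_mul (psi_pos t).le]
  congr 1
  have e1 : ((t : ℝ) + 2) / 2 = t / 2 + 1 := by ring
  have e2 : ((t : ℝ) + 3) / 2 = ((t + 1 : ℕ) : ℝ) / 2 + 1 := by push_cast; ring
  have h1 : Real.Gamma ((t : ℝ) / 2 + 1) ≠ 0 := (Real.Gamma_pos_of_pos (by positivity)).ne'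
  have h2 : Real.Gamma (((t + 1 : ℕ) : ℝ) / 2 + 1) ≠ 0 :=
    (Real.Gamma_pos_of_pos (by positivity)).ne'
  rw [psi, e1, e2]
  field_simp
  push_cast
  ring

/-! ### Half annuli in the tangent space. -/

/-- The half annulus `{w | r₁ < ‖w‖ < r₂, c < w i}`. -/
def halfAnnulus {t : ℕ} (i : Fin t) (r₁ r₂ c : ℝ) : Set (EuclideanSpace ℝ (Fin t)) :=
  {w | r₁ < ‖w‖ ∧ ‖w‖ < r₂ ∧ c < w i}

lemma measurableSet_halfAnnulus {t : ℕ} (i : Fin t) (r₁ r₂ c : ℝ) :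
    MeasurableSet (halfAnnulus i r₁ r₂ c) := by
  have h1 : MeasurableSet {w : EuclideanSpace ℝ (Fin t) | r₁ < ‖w‖} :=
    measurableSet_lt measurable_const measurable_norm
  have h2 : MeasurableSet {w : EuclideanSpace ℝ (Fin t) | ‖w‖ < r₂} :=
    measurableSet_lt measurable_norm measurable_const
  have h3 : MeasurableSet {w : EuclideanSpace ℝ (Fin t) | c < w i} :=
    measurableSet_lt measurable_const (by fun_prop)
  exact h1.inter (h2.inter h3)

lemma volume_annulus {t : ℕ} (ht : 1 ≤ t) {a b : ℝ} (hb : 0 ≤ b) (hab : b < a) :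
    volume {w : EuclideanSpace ℝ (Fin t) | b < ‖w‖ ∧ ‖w‖ < a} =
      ENNReal.ofReal (a ^ t - b ^ t) *
        volume (Metric.ball (0 : EuclideanSpace ℝ (Fin t)) 1) := by
  have : Nonempty (Fin t) := ⟨⟨0, ht⟩⟩
  have hset : {w : EuclideanSpace ℝ (Fin t) | b < ‖w‖ ∧ ‖w‖ < a} =
      Metric.ball 0 a \ Metric.closedBall 0 b := by
    ext w
    simp [and_comm]
  rw [hset, measure_sdiff (Metric.closedBall_subset_ball hab)
    measurableSet_closedBall.nullMeasurableSet measure_closedBall_lt_top.ne,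
    Measure.addHaar_closedBall _ _ hb, Measure.addHaar_ball _ _ (hb.trans hab.le),
    finrank_euclideanSpace, Fintype.card_fin, ENNReal.ofReal_sub _ (by positivity),
    ENNReal.sub_mul]
  exact fun _ _ => measure_ball_lt_top.ne

/-- The reflection `w ↦ -w` exchanges the two halves, and the hyperplane between them is null. -/
lemma volume_annulus_le_two_mul {t : ℕ} (i : Fin t) (a b : ℝ) :
    volume {w : EuclideanSpace ℝ (Fin t) | b < ‖w‖ ∧ ‖w‖ < a} ≤
      2 * volume (halfAnnulus i b a 0) := by
  have hnull : volume {w : EuclideanSpace ℝ (Fin t) | w i = 0} = 0 := by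
    have := Measure.addHaar_submodule (volume : Measure (EuclideanSpace ℝ (Fin t)))
      (LinearMap.ker (EuclideanSpace.proj i : EuclideanSpace ℝ (Fin t) →L[ℝ] ℝ).toLinearMap) ?_
    · exact this
    · intro h
      have h1 : EuclideanSpace.single i (1 : ℝ) ∈
          LinearMap.ker (EuclideanSpace.proj i : EuclideanSpace ℝ (Fin t) →L[ℝ] ℝ).toLinearMap := by
        rw [h]; trivial
      simp at h1
  have hneg : volume (Neg.neg ⁻¹' halfAnnulus i b a 0) = volume (halfAnnulus i b a 0) :=
    Measure.measure_preimage_neg _ _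
  calc volume {w : EuclideanSpace ℝ (Fin t) | b < ‖w‖ ∧ ‖w‖ < a}
      ≤ volume ((halfAnnulus i b a 0 ∪ Neg.neg ⁻¹' halfAnnulus i b a 0) ∪
          {w : EuclideanSpace ℝ (Fin t) | w i = 0}) := by
        refine measure_mono fun w hw => ?_
        rcases lt_trichotomy (w i) 0 with h | h | h
        · exact Or.inl (Or.inr ⟨by simpa using hw.1, by simpa using hw.2, by simpa using h⟩)
        · exact Or.inr h
        · exact Or.inl (Or.inl ⟨hw.1, hw.2, h⟩)
    _ ≤ volume (halfAnnulus i b a 0) + volume (halfAnnulus i b a 0) + 0 := by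
        refine (measure_union_le _ _).trans (add_le_add ((measure_union_le _ _).trans ?_) hnull.le)
        rw [hneg]
    _ = 2 * volume (halfAnnulus i b a 0) := by rw [add_zero, two_mul]

/-- Continuity from below buys a margin `η`: in the inner radius it absorbs the shortening of
lengths under projection, and in the coordinate `i` it beats the curvature of the sphere. -/
lemma exists_lt_volume_halfAnnulus {t : ℕ} (i : Fin t) (a b : ℝ) {c : ℝ≥0∞}
    (hc : c < volume (halfAnnulus i b a 0)) :
    ∃ η > 0, c < volume (halfAnnulus i (b + η) a η) := by
  have hmono : Monotone fun k : ℕ => halfAnnulus i (b + 1 / ((k : ℝ) + 1)) a (1 / ((k : ℝ) + 1)) := by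
    intro k m hkm w hw
    have h : 1 / ((m : ℝ) + 1) ≤ 1 / ((k : ℝ) + 1) := Nat.one_div_le_one_div hkm
    exact ⟨by linarith [hw.1], hw.2.1, by linarith [hw.2.2]⟩
  have hunion : ⋃ k : ℕ, halfAnnulus i (b + 1 / ((k : ℝ) + 1)) a (1 / ((k : ℝ) + 1)) =
      halfAnnulus i b a 0 := by
    ext w
    rw [Set.mem_iUnion]
    constructor
    · rintro ⟨k, h1, h2, h3⟩
      have h : 0 < 1 / ((k : ℝ) + 1) := Nat.one_div_pos_of_nat
      exact ⟨by linarith, h2, by linarith⟩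
    · rintro ⟨h1, h2, h3⟩
      obtain ⟨k, hk⟩ := exists_nat_one_div_lt (lt_min (sub_pos.2 h1) h3)
      exact ⟨k, by linarith [hk.trans_le (min_le_left _ _)], h2, hk.trans_le (min_le_right _ _)⟩
  have hlim := tendsto_measure_iUnion_atTop (μ := volume) hmono
  rw [hunion] at hlim
  obtain ⟨k, hk⟩ := (hlim.eventually (lt_mem_nhds hc)).exists
  exact ⟨1 / ((k : ℝ) + 1), Nat.one_div_pos_of_nat, hk⟩

/-! ### Frames on the sphere and neighbours closer to the pole. -/

lemma exists_orthonormalBasis_zero {t : ℕ} {x : EuclideanSpace ℝ (Fin (t + 1))} (hx : ‖x‖ = 1) :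
    ∃ B : OrthonormalBasis (Fin (t + 1)) ℝ (EuclideanSpace ℝ (Fin (t + 1))), B 0 = x := by
  have horth : Orthonormal ℝ (Set.domRestrict {(0 : Fin (t + 1))}
      (fun _ => x : Fin (t + 1) → EuclideanSpace ℝ (Fin (t + 1)))) :=
    ⟨fun _ => hx, fun i j hij => absurd (Subsingleton.elim i j) hij⟩
  obtain ⟨B, hB⟩ := horth.exists_orthonormalBasis_extension_of_card_eq (by simp)
  exact ⟨B, hB 0 rfl⟩

/-- An orthonormal frame at `x` whose direction `i` points along the sphere from `x` to `p`. -/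
lemma exists_orthonormalBasis_toward {t : ℕ} (i : Fin t) {x : EuclideanSpace ℝ (Fin (t + 1))}
    (hx : ‖x‖ = 1) (p : EuclideanSpace ℝ (Fin (t + 1))) :
    ∃ B : OrthonormalBasis (Fin (t + 1)) ℝ (EuclideanSpace ℝ (Fin (t + 1))), B 0 = x ∧
      ∃ β : ℝ, 0 ≤ β ∧ p = ⟪x, p⟫ • x + β • B i.succ := by
  by_cases hq : p - ⟪x, p⟫ • x = 0
  -- Here `p = ±x`: no direction is distinguished, and any frame works with `β = 0`.
  · obtain ⟨B, hB⟩ := exists_orthonormalBasis_zero hx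
    exact ⟨B, hB, 0, le_rfl, by rw [zero_smul, add_zero, ← sub_eq_zero, hq]⟩
  · set q := p - ⟪x, p⟫ • x with hqdef
    have hxq : ⟪x, q⟫ = 0 := by
      rw [hqdef, inner_sub_right, inner_smul_right, real_inner_self_eq_norm_sq, hx]
      ring
    have hq0 : ‖q‖ ≠ 0 := norm_ne_zero_iff.2 hq
    set u := ‖q‖⁻¹ • q with hu
    have hunorm : ‖u‖ = 1 := by
      rw [hu, norm_smul, norm_inv, norm_norm, inv_mul_cancel₀ hq0]
    have hxu : ⟪x, u⟫ = 0 := by rw [hu, inner_smul_right, hxq, mul_zero]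
    set v : Fin (t + 1) → EuclideanSpace ℝ (Fin (t + 1)) := fun j => if j = 0 then x else u with hv
    have horth : Orthonormal ℝ (Set.domRestrict {(0 : Fin (t + 1)), i.succ} v) := by
      constructor
      · rintro ⟨j, hj⟩
        by_cases h0 : j = 0 <;> simp [hv, h0, hx, hunorm]
      · rintro ⟨j, hj⟩ ⟨k, hk⟩ hjk
        have hjk' : j ≠ k := fun h => hjk (Subtype.ext h)
        rcases hj with rfl | rfl <;> rcases hk with rfl | rfl
        · exact absurd rfl hjk'
        · simpa [hv] using hxu
        · simpa [hv, real_inner_comm] using hxu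
        · exact absurd rfl hjk'
    obtain ⟨B, hB⟩ := horth.exists_orthonormalBasis_extension_of_card_eq (by simp)
    refine ⟨B, by simpa [hv] using hB 0 (by simp), ‖q‖, norm_nonneg _, ?_⟩
    rw [hB i.succ (by simp)]
    simp only [hv, Fin.succ_ne_zero, if_false, hu]
    rw [smul_inv_smul₀ hq0, hqdef]
    abel

lemma norm_sub_sq_of_unit {E : Type*} [NormedAddCommGroup E] [InnerProductSpace ℝ E] {x y : E}
    (hx : ‖x‖ = 1) (hy : ‖y‖ = 1) : ‖x - y‖ ^ 2 = 2 - 2 * ⟪x, y⟫ := by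
  rw [norm_sub_sq_real, hx, hy]
  ring

/-- The points of the annulus around `x` that are closer to `p` than `x` is. -/
def closerNbhd {t : ℕ} (p : Sphere t) (r₁ r₂ : ℝ) (x : Sphere t) : Set (Sphere t) :=
  {y | r₁ ≤ ‖(x : EuclideanSpace ℝ (Fin (t + 1))) - y‖ ∧
    ‖(x : EuclideanSpace ℝ (Fin (t + 1))) - y‖ ≤ r₂ ∧
    ‖(y : EuclideanSpace ℝ (Fin (t + 1))) - p‖ < ‖(x : EuclideanSpace ℝ (Fin (t + 1))) - p‖}

lemma measurableSet_closerNbhd_prod {t : ℕ} (p : Sphere t) (r₁ r₂ : ℝ) :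
    MeasurableSet {z : Sphere t × Sphere t | z.2 ∈ closerNbhd p r₁ r₂ z.1} := by
  have h1 : MeasurableSet {z : Sphere t × Sphere t |
      r₁ ≤ ‖(z.1 : EuclideanSpace ℝ (Fin (t + 1))) - z.2‖} :=
    measurableSet_le measurable_const (by fun_prop)
  have h2 : MeasurableSet {z : Sphere t × Sphere t |
      ‖(z.1 : EuclideanSpace ℝ (Fin (t + 1))) - z.2‖ ≤ r₂} :=
    measurableSet_le (by fun_prop) measurable_const
  have h3 : MeasurableSet {z : Sphere t × Sphere t |
      ‖(z.2 : EuclideanSpace ℝ (Fin (t + 1))) - p‖ <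
        ‖(z.1 : EuclideanSpace ℝ (Fin (t + 1))) - p‖} :=
    measurableSet_lt (by fun_prop) (by fun_prop)
  exact h1.inter (h2.inter h3)

lemma measurableSet_closerNbhd {t : ℕ} (p : Sphere t) (r₁ r₂ : ℝ) (x : Sphere t) :
    MeasurableSet (closerNbhd p r₁ r₂ x) :=
  measurable_prodMk_left (x := x) (measurableSet_closerNbhd_prod p r₁ r₂)

section Projection

variable {t : ℕ} (B : OrthonormalBasis (Fin (t + 1)) ℝ (EuclideanSpace ℝ (Fin (t + 1))))

lemma inner_zero_projection (w : EuclideanSpace ℝ (Fin t)) :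
    ⟪B 0, (√(1 + ‖w‖ ^ 2))⁻¹ • tangentPoint B w⟫ = (√(1 + ‖w‖ ^ 2))⁻¹ := by
  rw [inner_smul_right, inner_basis_tangentPoint_zero, mul_one]

lemma norm_projection (w : EuclideanSpace ℝ (Fin t)) :
    ‖(√(1 + ‖w‖ ^ 2))⁻¹ • tangentPoint B w‖ = 1 := by
  have hs : 0 < √(1 + ‖w‖ ^ 2) := by positivity
  rw [norm_smul, norm_tangentPoint, norm_inv, Real.norm_of_nonneg hs.le, inv_mul_cancel₀ hs.ne']

lemma norm_sub_projection_le (w : EuclideanSpace ℝ (Fin t)) :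
    ‖B 0 - (√(1 + ‖w‖ ^ 2))⁻¹ • tangentPoint B w‖ ≤ ‖w‖ := by
  refine le_of_sq_le_sq ?_ (norm_nonneg _)
  rw [norm_sub_sq_of_unit (B.orthonormal.1 0) (norm_projection B w), inner_zero_projection]
  set s := √(1 + ‖w‖ ^ 2) with hs
  have hsq : s ^ 2 = 1 + ‖w‖ ^ 2 := Real.sq_sqrt (by positivity)
  have hs1 : 1 ≤ s := Real.one_le_sqrt.2 (by nlinarith [sq_nonneg ‖w‖])
  have hs0 : 0 < s := by linarith
  have h : s * s⁻¹ = 1 := mul_inv_cancel₀ hs0.ne'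
  have hi0 : 0 < s⁻¹ := inv_pos.2 hs0
  have hi1 : s⁻¹ ≤ 1 := inv_le_one_of_one_le₀ hs1
  nlinarith [mul_nonneg (sub_nonneg.2 hs1) (sub_nonneg.2 hi1)]

/-- With `s = √(1 + ‖w‖²)`, the two sides differ by exactly `(s - 1)²`. -/
lemma le_norm_sub_projection_sq (w : EuclideanSpace ℝ (Fin t)) :
    ‖w‖ ^ 2 ≤
      ‖B 0 - (√(1 + ‖w‖ ^ 2))⁻¹ • tangentPoint B w‖ ^ 2 * (1 + ‖w‖ ^ 2) := by
  rw [norm_sub_sq_of_unit (B.orthonormal.1 0) (norm_projection B w), inner_zero_projection]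
  set s := √(1 + ‖w‖ ^ 2) with hs
  have hsq : s ^ 2 = 1 + ‖w‖ ^ 2 := Real.sq_sqrt (by positivity)
  have hs1 : 1 ≤ s := Real.one_le_sqrt.2 (by nlinarith [sq_nonneg ‖w‖])
  have hs0 : 0 < s := by linarith
  have h : s * s⁻¹ = 1 := mul_inv_cancel₀ hs0.ne'
  rw [← hsq]
  have h2 : (2 - 2 * s⁻¹) * s ^ 2 = 2 * s ^ 2 - 2 * s := by
    calc (2 - 2 * s⁻¹) * s ^ 2 = 2 * s ^ 2 - 2 * s * (s * s⁻¹) := by ring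
      _ = 2 * s ^ 2 - 2 * s := by rw [h, mul_one]
  nlinarith [sq_nonneg (s - 1)]

end Projection

/-- The scalar form of `⟪x, p⟫ < ⟪y, p⟫`, where `y` is the projection of `l • w`, `r = ‖w‖` and `v =
w i`. For `α > 0` the loss `α * (s - 1)` is at most `(l * a)² / 2`, while the gain exceeds `β * l *
η`. Since `d² = 2 * (1 - α) ≤ 2 * β²`, the bound `a² / η * l ≤ d` makes the gain larger. For `α ≤ 0`
there is no loss. -/
lemma mul_lt_add_of_far {a η l α β d r s v : ℝ} (hη : 0 < η) (hl : 0 < l) (ha : 0 < a)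
    (hβ : 0 ≤ β) (hαβ : α ^ 2 + β ^ 2 = 1) (hr0 : 0 ≤ r) (hd : d ^ 2 = 2 - 2 * α)
    (hfar : a ^ 2 / η * l ≤ d) (hs1 : 1 < s) (hsq : s ^ 2 = 1 + (l * r) ^ 2) (hra : r < a)
    (hv : η < v) : α * s < α + β * (l * v) := by
  have hwi : 0 < l * v := mul_pos hl (hη.trans hv)
  rcases lt_trichotomy α 0 with h | h | h
  · have h1 : 0 ≤ β * (l * v) := by positivity
    nlinarith
  · have hβ1 : β = 1 := by
      rw [h] at hαβ
      nlinarith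
    rw [h, hβ1]
    linarith
  · have hα1 : α ≤ 1 := by nlinarith [sq_nonneg β]
    have hs2 : s - 1 ≤ (l * a) ^ 2 / 2 := by
      have : (l * r) ^ 2 ≤ (l * a) ^ 2 := by gcongr
      nlinarith [sq_nonneg (s - 1)]
    have hβ2 : d ^ 2 ≤ 2 * β ^ 2 := by
      rw [hd]
      nlinarith
    have hβ3 : (a ^ 2 * l) ^ 2 ≤ 2 * (β * η) ^ 2 := by
      have h1 : (a ^ 2 / η * l) ^ 2 ≤ 2 * β ^ 2 :=
        (pow_le_pow_left₀ (by positivity) hfar 2).trans hβ2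
      have h2 : a ^ 2 * l = (a ^ 2 / η * l) * η := by field_simp
      rw [h2, mul_pow]
      calc (a ^ 2 / η * l) ^ 2 * η ^ 2 ≤ 2 * β ^ 2 * η ^ 2 := by gcongr
        _ = 2 * (β * η) ^ 2 := by ring
    have hβ4 : a ^ 2 * l / 2 < β * η := by
      have h1 : 0 < a ^ 2 * l := by positivity
      have h2 : 0 ≤ β * η := by positivity
      by_contra! h3
      have h4 : (β * η) ^ 2 ≤ (a ^ 2 * l / 2) ^ 2 := pow_le_pow_left₀ h2 h3 2
      nlinarith [pow_pos h1 2]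
    have hβ5 : (l * a) ^ 2 / 2 < β * (l * v) := by
      calc (l * a) ^ 2 / 2 = l * (a ^ 2 * l / 2) := by ring
        _ < l * (β * η) := by gcongr
        _ ≤ l * (β * v) := by gcongr
        _ = β * (l * v) := by ring
    have h6 : α * (s - 1) ≤ 1 * (s - 1) := by gcongr
    linarith

/-- The upper radius survives because chords are no longer than tangent lengths, the lower one
because `hsmall` lets the margin `η` pay for the shortening. Between unit vectors, closer to `p`
means a larger inner product with `p`. -/
lemma mem_closerNbhd_of_halfAnnulus {t : ℕ} {i : Fin t} {a b η l : ℝ} (hb : 0 ≤ b) (hη : 0 < η)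
    (hl : 0 < l) (hsmall : b ^ 2 * (1 + (l * a) ^ 2) ≤ (b + η) ^ 2) {x p : Sphere t}
    {B : OrthonormalBasis (Fin (t + 1)) ℝ (EuclideanSpace ℝ (Fin (t + 1)))} (hB : B 0 = x)
    {β : ℝ} (hβ : 0 ≤ β) (hp : (p : EuclideanSpace ℝ (Fin (t + 1))) =
      ⟪(x : EuclideanSpace ℝ (Fin (t + 1))), p⟫ • (x : EuclideanSpace ℝ (Fin (t + 1))) +
        β • B i.succ)
    (hfar : a ^ 2 / η * l ≤ ‖(x : EuclideanSpace ℝ (Fin (t + 1))) - p‖)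
    {w : EuclideanSpace ℝ (Fin t)} (hw : w ∈ halfAnnulus i (b + η) a η) {y : Sphere t}
    (hy : (y : EuclideanSpace ℝ (Fin (t + 1))) =
      (√(1 + ‖l • w‖ ^ 2))⁻¹ • tangentPoint B (l • w)) :
    y ∈ closerNbhd p (b * l) (a * l) x := by
  obtain ⟨hw1, hw2, hw3⟩ := hw
  have hx1 : ‖(x : EuclideanSpace ℝ (Fin (t + 1)))‖ = 1 := by simp
  have hy1 : ‖(y : EuclideanSpace ℝ (Fin (t + 1)))‖ = 1 := by simp
  have hp1 : ‖(p : EuclideanSpace ℝ (Fin (t + 1)))‖ = 1 := by simp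
  have hnw : ‖l • w‖ = l * ‖w‖ := by rw [norm_smul, Real.norm_of_nonneg hl.le]
  have hw0 : 0 < ‖w‖ := by linarith
  have ha0 : 0 < a := by linarith
  refine ⟨?_, ?_, ?_⟩
  · have h := le_norm_sub_projection_sq B (l • w)
    rw [← hy, hB, hnw] at h
    set d := ‖(x : EuclideanSpace ℝ (Fin (t + 1))) - y‖
    have hd : 0 ≤ d := norm_nonneg _
    by_contra! hlt
    have hbl : d ^ 2 < (b * l) ^ 2 := pow_lt_pow_left₀ hlt hd two_ne_zero
    have h1 : (l * ‖w‖) ^ 2 ≤ (l * a) ^ 2 := by gcongr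
    have h2 : d ^ 2 * (1 + (l * ‖w‖) ^ 2) ≤ d ^ 2 * (1 + (l * a) ^ 2) := by gcongr
    have h3 : d ^ 2 * (1 + (l * a) ^ 2) < (b * l) ^ 2 * (1 + (l * a) ^ 2) := by gcongr
    have h4 : (b * l) ^ 2 * (1 + (l * a) ^ 2) ≤ l ^ 2 * (b + η) ^ 2 := by
      calc (b * l) ^ 2 * (1 + (l * a) ^ 2) = l ^ 2 * (b ^ 2 * (1 + (l * a) ^ 2)) := by ring
        _ ≤ l ^ 2 * (b + η) ^ 2 := by gcongr
    have h5 : l ^ 2 * (b + η) ^ 2 ≤ (l * ‖w‖) ^ 2 := by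
      rw [mul_pow]
      gcongr
    linarith
  · have h := norm_sub_projection_le B (l • w)
    rw [← hy, hB, hnw] at h
    calc _ ≤ l * ‖w‖ := h
      _ ≤ l * a := by gcongr
      _ = a * l := mul_comm _ _
  · set α := ⟪(x : EuclideanSpace ℝ (Fin (t + 1))), (p : EuclideanSpace ℝ (Fin (t + 1)))⟫ with hα
    have hxu : ⟪(x : EuclideanSpace ℝ (Fin (t + 1))), B i.succ⟫ = 0 := by
      rw [← hB]
      exact B.orthonormal.2 (Fin.succ_ne_zero i).symm
    have hαβ : α ^ 2 + β ^ 2 = 1 := by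
      have h : ‖(p : EuclideanSpace ℝ (Fin (t + 1)))‖ ^ 2 = α ^ 2 + β ^ 2 := by
        rw [hp, norm_add_sq_real, norm_smul, norm_smul, hx1, B.orthonormal.1, inner_smul_left,
          inner_smul_right, hxu]
        simp
      rw [← h, hp1, one_pow]
    set s := √(1 + ‖l • w‖ ^ 2) with hs
    have hsq : s ^ 2 = 1 + (l * ‖w‖) ^ 2 := by
      rw [hs, Real.sq_sqrt (by positivity), hnw]
    have hs0 : 0 ≤ s := Real.sqrt_nonneg _
    have hlw : 0 < (l * ‖w‖) ^ 2 := by positivity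
    have hs1 : 1 < s := by nlinarith
    have hyp : ⟪(y : EuclideanSpace ℝ (Fin (t + 1))), (p : EuclideanSpace ℝ (Fin (t + 1)))⟫ =
        s⁻¹ * (α + β * (l * w i)) := by
      rw [hp, hy, inner_smul_left, inner_add_right, inner_smul_right, inner_smul_right,
        real_inner_comm, ← hB, inner_basis_tangentPoint_zero, real_inner_comm, inner_basis_tangentPoint_succ]
      simp
    have hxp := norm_sub_sq_of_unit hx1 hp1
    have hyp' := norm_sub_sq_of_unit hy1 hp1
    rw [hyp] at hyp'
    rw [← hα] at hxp
    have hkey : α * s < α + β * (l * w i) :=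
      mul_lt_add_of_far hη hl ha0 hβ hαβ (norm_nonneg _) hxp hfar hs1 hsq hw2 hw3
    have hlt : α < s⁻¹ * (α + β * (l * w i)) := by
      rw [inv_mul_eq_div, lt_div_iff₀ (by linarith)]
      exact hkey
    refine lt_of_pow_lt_pow_left₀ 2 (norm_nonneg _) ?_
    rw [hxp, hyp']
    linarith

/-! ### Lower bounds for probabilities on the sphere. -/

lemma uniformSphere_apply {t : ℕ} (A : Set (Sphere t)) :
    uniformSphere t A = ((volume : Measure (EuclideanSpace ℝ (Fin (t + 1)))).toSphere Set.univ)⁻¹ *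
      (volume : Measure (EuclideanSpace ℝ (Fin (t + 1)))).toSphere A := by
  rw [uniformSphere, Measure.smul_apply, smul_eq_mul]

/-- If the tangent region `l • W` projects into `A`, then `A` has at least about `l ^ t / ψ(t)` times
the relative volume of `W`. -/
lemma le_uniformSphere_of_tangent {t : ℕ} (ht : 1 ≤ t)
    (B : OrthonormalBasis (Fin (t + 1)) ℝ (EuclideanSpace ℝ (Fin (t + 1))))
    {W : Set (EuclideanSpace ℝ (Fin t))} (hW : MeasurableSet W) {ρ : ℝ}
    (hρ : ∀ w ∈ W, ‖w‖ ≤ ρ) {c : ℝ}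
    (hc : ENNReal.ofReal (c * psi t) * volume (Metric.ball (0 : EuclideanSpace ℝ (Fin t)) 1) ≤
      volume W) {l : ℝ} (hl : 0 < l) {A : Set (Sphere t)} (hA : MeasurableSet A)
    (hWA : ∀ w ∈ W, ∀ y : Sphere t, (y : EuclideanSpace ℝ (Fin (t + 1))) =
      (√(1 + ‖l • w‖ ^ 2))⁻¹ • tangentPoint B (l • w) → y ∈ A) :
    ENNReal.ofReal ((√(1 + (l * ρ) ^ 2))⁻¹ ^ (t + 1) * l ^ t * c) ≤ uniformSphere t A := by
  have : Nonempty (Fin t) := ⟨⟨0, ht⟩⟩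
  have hlW : MeasurableSet (l • W) := hW.const_smul₀ l
  have h := le_toSphere_of_tangent B hlW (ρ := l * ρ) (A := A) ?_ hA ?_
  · rw [uniformSphere_apply, toSphere_univ_eq_psi ht]
    have hv0 : volume (Metric.ball (0 : EuclideanSpace ℝ (Fin t)) 1) ≠ 0 :=
      (Metric.measure_ball_pos _ _ one_pos).ne'
    have hv1 : volume (Metric.ball (0 : EuclideanSpace ℝ (Fin t)) 1) ≠ ⊤ :=
      measure_ball_lt_top.ne
    have hψ : ENNReal.ofReal (psi t) ≠ 0 := by simpa using psi_pos t
    rw [← ENNReal.div_eq_inv_mul, ENNReal.le_div_iff_mul_le (Or.inl (mul_ne_zero hψ hv0))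
      (Or.inl (ENNReal.mul_ne_top ENNReal.ofReal_ne_top hv1))]
    refine le_trans ?_ h
    rw [Measure.addHaar_smul, finrank_euclideanSpace, Fintype.card_fin,
      abs_of_nonneg (by positivity), ENNReal.ofReal_mul (by positivity),
      ENNReal.ofReal_mul (by positivity), mul_assoc, mul_assoc]
    gcongr
    refine le_trans (le_of_eq ?_) hc
    rw [ENNReal.ofReal_mul' (psi_pos t).le, mul_assoc]
  · rintro _ ⟨w, hw, rfl⟩
    simp only [norm_smul, Real.norm_of_nonneg hl.le]
    gcongr
    exact hρ w hw
  · rintro _ ⟨w, hw, rfl⟩ y hy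
    exact hWA w hw y hy

lemma tendsto_shrink {t : ℕ} (ρ : ℝ) :
    Tendsto (fun l : ℝ => (√(1 + (l * ρ) ^ 2))⁻¹ ^ (t + 1)) (𝓝 0) (𝓝 1) := by
  have h : ContinuousAt (fun l : ℝ => (√(1 + (l * ρ) ^ 2))⁻¹ ^ (t + 1)) 0 := by
    refine ContinuousAt.pow (ContinuousAt.inv₀ (by fun_prop) (by simp)) _
  simpa [ContinuousAt] using h

/-- In the regime `l → 0`, away from `p` at scale `l` the points of the annulus that are closer to
`p` have measure at least `2 * l ^ t`. -/
lemma exists_le_uniformSphere_closerNbhd {t : ℕ} (ht : 1 ≤ t) {a b : ℝ} (hb : 0 ≤ b) (hab : b < a)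
    (hgap : 8 * psi t ≤ a ^ t - b ^ t) (p : Sphere t) :
    ∃ K > 0, ∀ᶠ l in 𝓝[>] (0 : ℝ), ∀ x : Sphere t,
      K * l ≤ ‖(x : EuclideanSpace ℝ (Fin (t + 1))) - p‖ →
        ENNReal.ofReal (2 * l ^ t) ≤ uniformSphere t (closerNbhd p (b * l) (a * l) x) := by
  have : Nonempty (Fin t) := ⟨⟨0, ht⟩⟩
  let i : Fin t := ⟨0, ht⟩
  have ha : 0 < a := hb.trans_lt hab
  have hv0 : volume (Metric.ball (0 : EuclideanSpace ℝ (Fin t)) 1) ≠ 0 :=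
    (Metric.measure_ball_pos _ _ one_pos).ne'
  have hv1 : volume (Metric.ball (0 : EuclideanSpace ℝ (Fin t)) 1) ≠ ⊤ :=
    measure_ball_lt_top.ne
  -- The gap hypothesis gives the half annulus a relative volume of at least `4 * psi t`. Lowering 4
  -- to 3 leaves room for `η`, and the shrink factor `2 / 3` below then leaves 2; the union bound
  -- needs a constant above 1.
  have hhalf : ENNReal.ofReal (3 * psi t) *
      volume (Metric.ball (0 : EuclideanSpace ℝ (Fin t)) 1) < volume (halfAnnulus i b a 0) := by
    have h1 := volume_annulus_le_two_mul i a b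
    rw [volume_annulus ht hb hab] at h1
    have h2 : 2 * (ENNReal.ofReal (3 * psi t) *
        volume (Metric.ball (0 : EuclideanSpace ℝ (Fin t)) 1)) <
        ENNReal.ofReal (a ^ t - b ^ t) *
          volume (Metric.ball (0 : EuclideanSpace ℝ (Fin t)) 1) := by
      rw [← mul_assoc]
      refine ENNReal.mul_lt_mul_left hv0 hv1 ?_
      rw [show (2 : ℝ≥0∞) = ENNReal.ofReal 2 by simp, ← ENNReal.ofReal_mul zero_le_two]
      refine (ENNReal.ofReal_lt_ofReal_iff ?_).2 ?_ <;> nlinarith [psi_pos t]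
    exact lt_of_mul_lt_mul_left' (h2.trans_le h1)
  obtain ⟨η, hη, hηvol⟩ := exists_lt_volume_halfAnnulus i a b hhalf
  -- The distance threshold of `mul_lt_add_of_far`.
  refine ⟨a ^ 2 / η, by positivity, ?_⟩
  have hlim1 := (tendsto_shrink (t := t) a).eventually (lt_mem_nhds (show (2 / 3 : ℝ) < 1 by norm_num))
  have hlim2 : ∀ᶠ l in 𝓝 (0 : ℝ), b ^ 2 * (1 + (l * a) ^ 2) < (b + η) ^ 2 := by
    have h : ContinuousAt (fun l : ℝ => b ^ 2 * (1 + (l * a) ^ 2)) 0 := by fun_prop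
    refine h.eventually (gt_mem_nhds ?_)
    simp only [zero_mul, ne_eq, OfNat.ofNat_ne_zero, not_false_eq_true, zero_pow, add_zero, mul_one]
    gcongr
    linarith
  filter_upwards [nhdsWithin_le_nhds hlim1, nhdsWithin_le_nhds hlim2, self_mem_nhdsWithin]
    with l h1 h2 hl x hx
  have hl : 0 < l := hl
  obtain ⟨B, hB, β, hβ, hp⟩ := exists_orthonormalBasis_toward i
    (show ‖(x : EuclideanSpace ℝ (Fin (t + 1)))‖ = 1 by simp) p
  refine le_trans (ENNReal.ofReal_le_ofReal ?_) (le_uniformSphere_of_tangent ht B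
    (measurableSet_halfAnnulus i (b + η) a η) (ρ := a) (fun w hw => hw.2.1.le) hηvol.le hl
    (measurableSet_closerNbhd p (b * l) (a * l) x)
    fun w hw y hy => mem_closerNbhd_of_halfAnnulus hb hη hl h2.le hB hβ hp hx hw hy)
  have : 0 < l ^ t := by positivity
  nlinarith

/-- Small caps of radius `η * l` have measure at least `c * l ^ t`. -/
lemma exists_le_uniformSphere_cap {t : ℕ} (ht : 1 ≤ t) {η : ℝ} (hη : 0 < η) :
    ∃ c > 0, ∀ᶠ l in 𝓝[>] (0 : ℝ), ∀ x : Sphere t,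
      ENNReal.ofReal (c * l ^ t) ≤ uniformSphere t (Metric.closedBall x (η * l)) := by
  have : Nonempty (Fin t) := ⟨⟨0, ht⟩⟩
  have hψ := psi_pos t
  refine ⟨η ^ t / psi t / 2, by positivity, ?_⟩
  have hlim := (tendsto_shrink (t := t) η).eventually (lt_mem_nhds (show (1 / 2 : ℝ) < 1 by norm_num))
  filter_upwards [nhdsWithin_le_nhds hlim, self_mem_nhdsWithin] with l h1 hl x
  have hl : 0 < l := hl
  obtain ⟨B, hB⟩ := exists_orthonormalBasis_zero
    (show ‖(x : EuclideanSpace ℝ (Fin (t + 1)))‖ = 1 by simp)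
  refine le_trans (ENNReal.ofReal_le_ofReal ?_) (le_uniformSphere_of_tangent ht B
    (W := Metric.ball 0 η) measurableSet_ball (ρ := η) (fun w hw => (mem_ball_zero_iff.1 hw).le)
    (c := η ^ t / psi t) ?_ hl measurableSet_closedBall ?_)
  · have : 0 < l ^ t * (η ^ t / psi t) := by positivity
    nlinarith
  · rw [div_mul_cancel₀ _ hψ.ne', Measure.addHaar_ball _ _ hη.le, finrank_euclideanSpace,
      Fintype.card_fin]
  · intro w hw y hy
    rw [Metric.mem_closedBall, dist_comm, Subtype.dist_eq, dist_eq_norm, hy, ← hB]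
    refine (norm_sub_projection_le B _).trans ?_
    rw [norm_smul, Real.norm_of_nonneg hl.le, mul_comm]
    gcongr
    exact (mem_ball_zero_iff.1 hw).le

/-! ### Union bounds for independent samples. -/

section Occupancy

variable {S : Type*} [MeasurableSpace S] (μ : Measure S) [IsProbabilityMeasure μ]

lemma pi_forall_notMem_le {A : Set S} (hA : MeasurableSet A) {q : ℝ≥0∞} (hq : q ≤ μ A) (n : ℕ) :
    Measure.pi (fun _ : Fin n => μ) {X | ∀ j, X j ∉ A} ≤ (1 - q) ^ n := by
  have : {X : Fin n → S | ∀ j, X j ∉ A} = Set.univ.pi fun _ => Aᶜ := by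
    ext X
    simp
  rw [this, Measure.pi_pi, Finset.prod_const, Finset.card_univ, Fintype.card_fin,
    prob_compl_eq_one_sub hA]
  gcongr

lemma pi_exists_forall_notMem_le {ι : Type*} (Z : Finset ι) {A : ι → Set S}
    (hA : ∀ z, MeasurableSet (A z)) {q : ℝ≥0∞} (hq : ∀ z, q ≤ μ (A z)) (n : ℕ) :
    Measure.pi (fun _ : Fin n => μ) {X | ∃ z ∈ Z, ∀ j, X j ∉ A z} ≤ Z.card * (1 - q) ^ n := by
  have : {X : Fin n → S | ∃ z ∈ Z, ∀ j, X j ∉ A z} = ⋃ z ∈ Z, {X | ∀ j, X j ∉ A z} := by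
    ext X
    simp
  rw [this]
  refine (measure_biUnion_finset_le _ _).trans ?_
  refine (Finset.sum_le_card_nsmul _ _ _ fun z _ => pi_forall_notMem_le μ (hA z) (hq z) n).trans ?_
  rw [nsmul_eq_mul]

/-- If every point of `D` has a neighbourhood of measure at least `q`, then it is unlikely that the
neighbourhood of some sample point in `D` contains no other sample point. -/
lemma pi_exists_isolated_le {D : Set S} (hD : MeasurableSet D) {N : S → Set S}
    (hN : MeasurableSet {z : S × S | z.2 ∈ N z.1}) {q : ℝ≥0∞} (hq : ∀ x ∈ D, q ≤ μ (N x)) (n : ℕ) :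
    Measure.pi (fun _ : Fin n => μ) {X | ∃ i, X i ∈ D ∧ ∀ j, j ≠ i → X j ∉ N (X i)} ≤
      n * (1 - q) ^ (n - 1) := by
  have hunion : {X : Fin n → S | ∃ i, X i ∈ D ∧ ∀ j, j ≠ i → X j ∉ N (X i)} =
      ⋃ i ∈ (Finset.univ : Finset (Fin n)),
        {X | X i ∈ D ∧ ∀ j, j ≠ i → X j ∉ N (X i)} := by
    ext X
    simp
  rw [hunion]
  refine (measure_biUnion_finset_le _ _).trans ?_
  refine (Finset.sum_le_card_nsmul _ _ ((1 - q) ^ (n - 1)) fun i _ => ?_).trans ?_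
  · obtain _ | n := n
    · exact i.elim0
    -- Conditioning on the position of vertex `i` fixes its neighbourhood; the other `n` of the `n +
    -- 1` points miss it independently.
    have hmp := measurePreserving_piFinSuccAbove (fun _ : Fin (n + 1) => μ) i
    let T : Set (S × (Fin n → S)) := {z | z.1 ∈ D ∧ ∀ k, z.2 k ∉ N z.1}
    have hT : MeasurableSet T := by
      have h : T = {z | z.1 ∈ D} ∩ ⋂ k, {z | z.2 k ∈ N z.1}ᶜ := by
        ext z
        simp [T]
      rw [h]
      refine (measurable_fst hD).inter (MeasurableSet.iInter fun k => MeasurableSet.compl ?_)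
      have h : Measurable fun z : S × (Fin n → S) => (z.1, z.2 k) :=
        measurable_fst.prodMk ((measurable_pi_apply k).comp measurable_snd)
      exact h hN
    have hset : {X : Fin (n + 1) → S | X i ∈ D ∧ ∀ j, j ≠ i → X j ∉ N (X i)} =
        MeasurableEquiv.piFinSuccAbove (fun _ => S) i ⁻¹' T := by
      ext X
      refine and_congr Iff.rfl ⟨fun h k => h _ (Fin.succAbove_ne i k), fun h j hj => ?_⟩
      obtain ⟨k, rfl⟩ := Fin.exists_succAbove_eq hj
      exact h k
    rw [hset, hmp.measure_preimage hT.nullMeasurableSet, Measure.prod_apply hT]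
    calc _ ≤ ∫⁻ _ : S, (1 - q) ^ n ∂μ := by
          refine lintegral_mono fun x => ?_
          by_cases hx : x ∈ D
          · refine le_trans (measure_mono ?_) (pi_forall_notMem_le μ
              (A := N x) (measurable_prodMk_left (x := x) hN) (hq x hx) n)
            exact fun f hf => hf.2
          · have : Prod.mk x ⁻¹' T = ∅ := by
              ext f
              simp [T, hx]
            rw [this, measure_empty]
            exact zero_le
      _ = (1 - q) ^ (n + 1 - 1) := by simp
  · simp

end Occupancy

/-- At every scale `l`, the cap of radius `K * l` is covered by a bounded number of caps of
radius `η * l`. -/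
lemma exists_card_le_cover_cap {t : ℕ} (p : Sphere t) (K : ℝ) {η : ℝ} (hη : 0 < η) :
    ∃ M : ℕ, ∀ l : ℝ, 0 < l → ∃ Z : Finset (Sphere t), Z.card ≤ M ∧
      ∀ q : Sphere t, dist q p ≤ K * l → ∃ z ∈ Z, dist q z ≤ η * l := by
  classical
  -- One finite cover in the ambient space serves every scale by dilation. Its centres need not lie
  -- on the translated and rescaled sphere, so each is replaced by a nearby sphere point, which
  -- doubles the radius from `η / 2` to `η`.
  obtain ⟨T, -, hTfin, hT⟩ := (isCompact_closedBall (0 : EuclideanSpace ℝ (Fin (t + 1)))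
    K).finite_cover_balls (half_pos hη)
  refine ⟨hTfin.toFinset.card, fun l hl => ?_⟩
  have hz : ∀ f : EuclideanSpace ℝ (Fin (t + 1)), ∃ z : Sphere t,
      ∀ q : Sphere t, ‖(q - p : EuclideanSpace ℝ (Fin (t + 1))) - l • f‖ ≤ l * (η / 2) →
        dist q z ≤ η * l := by
    intro f
    by_cases h : ∃ z : Sphere t, ‖(z - p : EuclideanSpace ℝ (Fin (t + 1))) - l • f‖ ≤ l * (η / 2)
    · obtain ⟨z, hz⟩ := h
      refine ⟨z, fun q hq => ?_⟩
      rw [Subtype.dist_eq, dist_eq_norm]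
      calc ‖(q - z : EuclideanSpace ℝ (Fin (t + 1)))‖
          = ‖((q - p : EuclideanSpace ℝ (Fin (t + 1))) - l • f) -
              ((z - p : EuclideanSpace ℝ (Fin (t + 1))) - l • f)‖ := by
            congr 1
            abel
        _ ≤ l * (η / 2) + l * (η / 2) := (norm_sub_le _ _).trans (add_le_add hq hz)
        _ = η * l := by ring
    -- This ball misses the sphere; `p` is a dummy value.
    · exact ⟨p, fun q hq => absurd ⟨q, hq⟩ h⟩
  choose z hz using hz
  refine ⟨hTfin.toFinset.image z, Finset.card_image_le, fun q hq => ?_⟩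
  have hmem : l⁻¹ • (q - p : EuclideanSpace ℝ (Fin (t + 1))) ∈
      Metric.closedBall (0 : EuclideanSpace ℝ (Fin (t + 1))) K := by
    rw [Subtype.dist_eq, dist_eq_norm] at hq
    rw [mem_closedBall_zero_iff, norm_smul, norm_inv, Real.norm_of_nonneg hl.le,
      inv_mul_le_iff₀ hl, mul_comm]
    exact hq
  obtain ⟨f, hf, hqf⟩ := Set.mem_iUnion₂.1 (hT hmem)
  refine ⟨z f, Finset.mem_image_of_mem _ (hTfin.mem_toFinset.2 hf), hz f q ?_⟩
  rw [mem_ball_iff_norm] at hqf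
  have heq : (q - p : EuclideanSpace ℝ (Fin (t + 1))) - l • f =
      l • (l⁻¹ • (q - p : EuclideanSpace ℝ (Fin (t + 1))) - f) := by
    rw [smul_sub, smul_inv_smul₀ hl.ne']
  rw [heq, norm_smul, Real.norm_of_nonneg hl.le]
  gcongr

/-! ### Asymptotics of the failure probabilities. -/

lemma one_sub_ofReal_pow_le {x : ℝ} (n : ℕ) :
    (1 - ENNReal.ofReal x) ^ n ≤ ENNReal.ofReal (Real.exp (-(n * x))) := by
  have h : 1 - ENNReal.ofReal x ≤ ENNReal.ofReal (Real.exp (-x)) := by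
    rw [tsub_le_iff_right, ← ENNReal.ofReal_one]
    refine le_trans (ENNReal.ofReal_le_ofReal ?_) ENNReal.ofReal_add_le
    linarith [Real.add_one_le_exp (-x)]
  calc (1 - ENNReal.ofReal x) ^ n ≤ ENNReal.ofReal (Real.exp (-x)) ^ n := by gcongr
    _ = ENNReal.ofReal (Real.exp (-(n * x))) := by
      rw [← ENNReal.ofReal_pow (Real.exp_pos _).le, ← Real.exp_nat_mul]
      congr 2
      ring

lemma tendsto_log_div_nat : Tendsto (fun n : ℕ => Real.log n / n) atTop (𝓝 0) := by
  have h := (Real.tendsto_pow_log_div_mul_add_atTop 1 0 1 one_ne_zero).comp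
    (tendsto_natCast_atTop_atTop (R := ℝ))
  simpa [Function.comp_def] using h

lemma tendsto_const_mul_one_sub_pow (M : ℕ) {c : ℝ} (hc : 0 < c) :
    Tendsto (fun n : ℕ => (M : ℝ≥0∞) * (1 - ENNReal.ofReal (c * (Real.log n / n))) ^ n)
      atTop (𝓝 0) := by
  have hlim : Tendsto (fun n : ℕ => (M : ℝ) * Real.exp (-(c * Real.log n))) atTop (𝓝 0) := by
    have h : Tendsto (fun n : ℕ => c * Real.log n) atTop atTop :=
      (Real.tendsto_log_atTop.comp tendsto_natCast_atTop_atTop).const_mul_atTop hc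
    simpa using (Real.tendsto_exp_neg_atTop_nhds_zero.comp h).const_mul (M : ℝ)
  have hlim' := ENNReal.tendsto_ofReal hlim
  rw [ENNReal.ofReal_zero] at hlim'
  refine tendsto_of_tendsto_of_tendsto_of_le_of_le' tendsto_const_nhds hlim'
    (Eventually.of_forall fun _ => zero_le) ?_
  filter_upwards [eventually_gt_atTop 0] with n hn
  rw [ENNReal.ofReal_mul (Nat.cast_nonneg _), ENNReal.ofReal_natCast]
  gcongr
  refine (one_sub_ofReal_pow_le n).trans (le_of_eq ?_)
  congr 3
  have : (n : ℝ) ≠ 0 := by positivity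
  field_simp

/-- The coefficient 2 turns `n` into `exp (-log n)`, and the exponent `n - 1` costs only the factor
`exp (2 * log n / n)`, which tends to 1. -/
lemma tendsto_mul_one_sub_pow_pred :
    Tendsto (fun n : ℕ => (n : ℝ≥0∞) * (1 - ENNReal.ofReal (2 * (Real.log n / n))) ^ (n - 1))
      atTop (𝓝 0) := by
  have hlog : Tendsto (fun n : ℕ => Real.log n) atTop atTop :=
    Real.tendsto_log_atTop.comp tendsto_natCast_atTop_atTop
  have hlim : Tendsto (fun n : ℕ => Real.exp (-(Real.log n)) * Real.exp (2 * (Real.log n / n)))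
      atTop (𝓝 0) := by
    have h1 := Real.tendsto_exp_neg_atTop_nhds_zero.comp hlog
    have h2 := (Real.continuous_exp.tendsto (2 * 0)).comp (tendsto_log_div_nat.const_mul 2)
    simpa using h1.mul h2
  have hlim' := ENNReal.tendsto_ofReal hlim
  rw [ENNReal.ofReal_zero] at hlim'
  refine tendsto_of_tendsto_of_tendsto_of_le_of_le' tendsto_const_nhds hlim'
    (Eventually.of_forall fun _ => zero_le) ?_
  filter_upwards [eventually_gt_atTop 0] with n hn
  have hn' : (0 : ℝ) < n := by exact_mod_cast hn
  calc (n : ℝ≥0∞) * (1 - ENNReal.ofReal (2 * (Real.log n / n))) ^ (n - 1)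
      ≤ ENNReal.ofReal n *
          ENNReal.ofReal (Real.exp (-(((n - 1 : ℕ) : ℝ) * (2 * (Real.log n / n))))) := by
        rw [ENNReal.ofReal_natCast]
        gcongr
        exact one_sub_ofReal_pow_le _
    _ = ENNReal.ofReal (Real.exp (-(Real.log n)) * Real.exp (2 * (Real.log n / n))) := by
        rw [← ENNReal.ofReal_mul hn'.le]
        congr 1
        rw [Nat.cast_sub hn, Nat.cast_one]
        conv_lhs => rw [← Real.exp_log hn']
        rw [← Real.exp_add, ← Real.exp_add, Real.exp_log hn']
        congr 1
        field_simp
        ring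

/-! ### Deterministic connectivity from drift and density. -/

lemma exists_norm_sub_eq {t : ℕ} (ht : 1 ≤ t) (x : Sphere t) {d : ℝ} (hd : 0 ≤ d) (hd2 : d ≤ 2) :
    ∃ q : Sphere t, ‖(x : EuclideanSpace ℝ (Fin (t + 1))) - q‖ = d := by
  obtain ⟨B, hB⟩ := exists_orthonormalBasis_zero
    (show ‖(x : EuclideanSpace ℝ (Fin (t + 1)))‖ = 1 by simp)
  let i : Fin t := ⟨0, ht⟩
  have hxu : ⟪(x : EuclideanSpace ℝ (Fin (t + 1))), B i.succ⟫ = 0 := by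
    rw [← hB]
    exact B.orthonormal.2 (Fin.succ_ne_zero i).symm
  set c := 1 - d ^ 2 / 2 with hcdef
  have hc : c ^ 2 ≤ 1 := by
    rw [sq_le_one_iff_abs_le_one, abs_le]
    constructor <;> nlinarith
  have hx : ‖(x : EuclideanSpace ℝ (Fin (t + 1)))‖ = 1 := by simp
  have hq : ‖c • (x : EuclideanSpace ℝ (Fin (t + 1))) + √(1 - c ^ 2) • B i.succ‖ = 1 := by
    have h : ‖c • (x : EuclideanSpace ℝ (Fin (t + 1))) + √(1 - c ^ 2) • B i.succ‖ ^ 2 = 1 := by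
      rw [norm_add_sq_real, norm_smul, norm_smul, hx, B.orthonormal.1, inner_smul_left,
        inner_smul_right, hxu, mul_one, mul_one, Real.norm_eq_abs, Real.norm_eq_abs, sq_abs, sq_abs,
        Real.sq_sqrt (by linarith)]
      ring
    exact (pow_eq_one_iff_of_nonneg (norm_nonneg _) two_ne_zero).1 h
  refine ⟨⟨_, mem_sphere_zero_iff_norm.2 hq⟩, ?_⟩
  rw [← pow_left_inj₀ (norm_nonneg _) hd two_ne_zero, norm_sub_sq_of_unit hx hq, inner_add_right,
    inner_smul_right, inner_smul_right, hxu, real_inner_self_eq_norm_sq, hx]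
  ring

/-- A point at distance about `δ` from `x` in the direction of `p`. -/
lemma exists_near_chord {t : ℕ} (x p : Sphere t) {δ : ℝ} (hδ : 0 < δ)
    (hδd : δ ≤ ‖(x : EuclideanSpace ℝ (Fin (t + 1))) - p‖)
    (hd : ‖(x : EuclideanSpace ℝ (Fin (t + 1))) - p‖ ≤ 1 / 4) :
    ∃ q : Sphere t, ‖(x : EuclideanSpace ℝ (Fin (t + 1))) - q‖ ≤ δ + δ / 4 ∧
      ‖(q : EuclideanSpace ℝ (Fin (t + 1))) - p‖ ≤
        ‖(x : EuclideanSpace ℝ (Fin (t + 1))) - p‖ - δ + δ / 4 := by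
  have hx : ‖(x : EuclideanSpace ℝ (Fin (t + 1)))‖ = 1 := by simp
  have hp : ‖(p : EuclideanSpace ℝ (Fin (t + 1)))‖ = 1 := by simp
  obtain ⟨X, hX⟩ := x
  obtain ⟨P, hP⟩ := p
  simp only at hx hp hδd hd ⊢
  set d := ‖X - P‖ with hd_def
  have hd0 : 0 < d := hδ.trans_le hδd
  set s := δ / d with hs
  have hsd : s * d = δ := div_mul_cancel₀ _ hd0.ne'
  have hs0 : 0 < s := div_pos hδ hd0
  have hs1 : s ≤ 1 := (div_le_one hd0).2 hδd
  set c := X - s • (X - P) with hc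
  have hcx : ‖X - c‖ = δ := by
    rw [hc, sub_sub_cancel, norm_smul, Real.norm_of_nonneg hs0.le, ← hd_def, hsd]
  have hcp : ‖c - P‖ = d - δ := by
    have : c - P = (1 - s) • (X - P) := by
      rw [hc, sub_smul, one_smul]
      abel
    rw [this, norm_smul, Real.norm_of_nonneg (by linarith), ← hd_def, sub_mul, one_mul, hsd]
  have hcsq : ‖c‖ ^ 2 = 1 - s * (1 - s) * d ^ 2 := by
    have h1 := norm_sub_sq_of_unit hx hp
    have h2 : ⟪X, X - P⟫ = d ^ 2 / 2 := by
      rw [inner_sub_right, real_inner_self_eq_norm_sq, hx, hd_def, h1]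
      ring
    rw [hc, norm_sub_sq_real, hx, inner_smul_right, h2, norm_smul, Real.norm_of_nonneg hs0.le,
      ← hd_def]
    ring
  have hc1 : ‖c‖ ≤ 1 := by
    have h : 0 ≤ s * (1 - s) * d ^ 2 :=
      mul_nonneg (mul_nonneg hs0.le (by linarith)) (sq_nonneg _)
    nlinarith [norm_nonneg c]
  -- The sag of the chord: `1 - ‖c‖ ≤ 1 - ‖c‖² = (s * d) * ((1 - s) * d) ≤ δ * d`, with `d ≤ 1 / 4`.
  -- Radial projection of `c` to the sphere moves it by this much.
  have hc2 : 1 - ‖c‖ ≤ δ / 4 := by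
    have h1 : s * (1 - s) * d ^ 2 ≤ δ * (1 / 4) := by
      calc s * (1 - s) * d ^ 2 = (s * d) * ((1 - s) * d) := by ring
        _ = δ * ((1 - s) * d) := by rw [hsd]
        _ ≤ δ * (1 / 4) := by
          gcongr
          nlinarith
    nlinarith [norm_nonneg c]
  have hc0 : 0 < ‖c‖ := by linarith
  have hqn : ‖‖c‖⁻¹ • c‖ = 1 := by
    rw [norm_smul, norm_inv, norm_norm, inv_mul_cancel₀ hc0.ne']
  have hqc : ‖‖c‖⁻¹ • c - c‖ ≤ δ / 4 := by
    have h : ‖c‖⁻¹ • c - c = (‖c‖⁻¹ - 1) • c := by rw [sub_smul, one_smul]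
    have h1 : 1 ≤ ‖c‖⁻¹ := (one_le_inv₀ hc0).2 hc1
    rw [h, norm_smul, Real.norm_of_nonneg (by linarith), sub_mul, inv_mul_cancel₀ hc0.ne', one_mul]
    exact hc2
  refine ⟨⟨‖c‖⁻¹ • c, mem_sphere_zero_iff_norm.2 hqn⟩, ?_, ?_⟩
  · calc ‖X - ‖c‖⁻¹ • c‖ ≤ ‖X - c‖ + ‖c - ‖c‖⁻¹ • c‖ := norm_sub_le_norm_sub_add_norm_sub _ _ _
      _ ≤ δ + δ / 4 := by
        rw [norm_sub_rev c, hcx]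
        gcongr
  · calc ‖‖c‖⁻¹ • c - P‖ ≤ ‖‖c‖⁻¹ • c - c‖ + ‖c - P‖ := norm_sub_le_norm_sub_add_norm_sub _ _ _
      _ ≤ d - δ + δ / 4 := by
        rw [hcp]
        linarith

/-- Close vertices may be too close to be adjacent, so they are joined through a common neighbour. A
sample point `k` near a point at the middle distance `(r₁ + r₂) / 2` from `X i` is off the middle of
the annulus by at most `ε + δ`, seen from any vertex within `δ` of `X i`. -/
lemma reachable_of_near {t n : ℕ} (ht : 1 ≤ t) {X : Fin n → Sphere t} {p : Sphere t}
    {r₁ r₂ R ε δ : ℝ} (hr₁ : 0 ≤ r₁) (hr₂ : r₂ ≤ 2) (hgap : 2 * (ε + δ) < r₂ - r₁) (hε : 0 ≤ ε)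
    (hδ : 0 ≤ δ)
    (hdense : ∀ q : Sphere t, ‖(q : EuclideanSpace ℝ (Fin (t + 1))) - p‖ ≤ R + r₂ →
      ∃ j, ‖(q : EuclideanSpace ℝ (Fin (t + 1))) - X j‖ ≤ ε)
    {i j : Fin n} (hi : ‖(X i : EuclideanSpace ℝ (Fin (t + 1))) - p‖ ≤ R)
    (hij : ‖(X i : EuclideanSpace ℝ (Fin (t + 1))) - X j‖ ≤ δ) :
    (annulusGraph X r₁ r₂).Reachable i j := by
  obtain ⟨q, hq⟩ := exists_norm_sub_eq ht (X i) (d := (r₁ + r₂) / 2) (by linarith) (by linarith)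
  obtain ⟨k, hk⟩ := hdense q (by
    have := norm_sub_le_norm_sub_add_norm_sub (q : EuclideanSpace ℝ (Fin (t + 1))) (X i) p
    rw [norm_sub_rev _ (X i : EuclideanSpace ℝ (Fin (t + 1)))] at this
    linarith)
  have hadj : ∀ m : Fin n, ‖(X i : EuclideanSpace ℝ (Fin (t + 1))) - X m‖ ≤ δ →
      (annulusGraph X r₁ r₂).Adj m k := by
    intro m hm
    have h1 : ‖(X m : EuclideanSpace ℝ (Fin (t + 1))) - X k‖ ≤ (r₁ + r₂) / 2 + (ε + δ) := by
      calc ‖(X m : EuclideanSpace ℝ (Fin (t + 1))) - X k‖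
          = ‖((X m : EuclideanSpace ℝ (Fin (t + 1))) - X i) + (X i - q) + (q - X k)‖ := by
            congr 1
            abel
        _ ≤ δ + (r₁ + r₂) / 2 + ε := by
            refine norm_add₃_le.trans ?_
            rw [norm_sub_rev (X m : EuclideanSpace ℝ (Fin (t + 1))), hq]
            gcongr
        _ = (r₁ + r₂) / 2 + (ε + δ) := by ring
    have h2 : (r₁ + r₂) / 2 ≤ ‖(X m : EuclideanSpace ℝ (Fin (t + 1))) - X k‖ + (ε + δ) := by
      calc (r₁ + r₂) / 2 = ‖((X i : EuclideanSpace ℝ (Fin (t + 1))) - X m) + (X m - X k) +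
              (X k - q)‖ := by
            rw [← hq]
            congr 1
            abel
        _ ≤ δ + ‖(X m : EuclideanSpace ℝ (Fin (t + 1))) - X k‖ + ε := by
            refine norm_add₃_le.trans ?_
            rw [norm_sub_rev (X k : EuclideanSpace ℝ (Fin (t + 1)))]
            gcongr
        _ = ‖(X m : EuclideanSpace ℝ (Fin (t + 1))) - X k‖ + (ε + δ) := by ring
    refine ⟨?_, by linarith, by linarith⟩
    rintro rfl
    rw [sub_self, norm_zero] at h2
    linarith
  exact (hadj i (by simpa using hδ)).reachable.trans (hadj j hij).reachable.symm

/-- The annulus graph is connected as soon as its vertices are dense near `p` and every vertex far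
from `p` has a neighbour closer to `p`. -/
lemma connected_annulusGraph {t n : ℕ} (ht : 1 ≤ t) {X : Fin n → Sphere t} {p : Sphere t}
    {r₁ r₂ R ε : ℝ} (hr₁ : 0 ≤ r₁) (hr₂ : r₂ ≤ 2) (hε : 0 < ε) (hgap : 20 * ε ≤ r₂ - r₁)
    (hεR : 4 * ε ≤ R) (hR : R ≤ 1 / 4)
    (hdense : ∀ q : Sphere t, ‖(q : EuclideanSpace ℝ (Fin (t + 1))) - p‖ ≤ R + r₂ →
      ∃ j, ‖(q : EuclideanSpace ℝ (Fin (t + 1))) - X j‖ ≤ ε)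
    (hcloser : ∀ i, R ≤ ‖(X i : EuclideanSpace ℝ (Fin (t + 1))) - p‖ →
      ∃ j, j ≠ i ∧ X j ∈ closerNbhd p r₁ r₂ (X i)) :
    (annulusGraph X r₁ r₂).Connected := by
  have hstep : ∀ i, 4 * ε ≤ ‖(X i : EuclideanSpace ℝ (Fin (t + 1))) - p‖ →
      ∃ j, (annulusGraph X r₁ r₂).Reachable i j ∧
        ‖(X j : EuclideanSpace ℝ (Fin (t + 1))) - p‖ <
          ‖(X i : EuclideanSpace ℝ (Fin (t + 1))) - p‖ := by
    intro i hi
    rcases le_total R ‖(X i : EuclideanSpace ℝ (Fin (t + 1))) - p‖ with h | h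
    · obtain ⟨j, hji, h1, h2, h3⟩ := hcloser i h
      have hadj : (annulusGraph X r₁ r₂).Adj i j := ⟨hji.symm, h1, h2⟩
      exact ⟨j, hadj.reachable, h3⟩
    -- The point `q` is within `5 * ε` of `X i` and at least `3 * ε` closer to `p`. A sample point
    -- within `ε` of `q` is thus within `6 * ε` of `X i` and still at least `2 * ε` closer.
    · obtain ⟨q, hq1, hq2⟩ := exists_near_chord (X i) p (δ := 4 * ε) (by linarith) hi (h.trans hR)
      obtain ⟨j, hj⟩ := hdense q (by linarith)
      have h1 := norm_sub_le_norm_sub_add_norm_sub (X i : EuclideanSpace ℝ (Fin (t + 1))) q (X j)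
      have h2 := norm_sub_le_norm_sub_add_norm_sub (X j : EuclideanSpace ℝ (Fin (t + 1))) q p
      rw [norm_sub_rev (X j : EuclideanSpace ℝ (Fin (t + 1))) q] at h2
      exact ⟨j, reachable_of_near ht hr₁ hr₂ (δ := 6 * ε) (by linarith) hε.le (by linarith) hdense h
        (by linarith), by linarith⟩
  have hnear : ∀ i, ∃ j, (annulusGraph X r₁ r₂).Reachable i j ∧
      ‖(X j : EuclideanSpace ℝ (Fin (t + 1))) - p‖ < 4 * ε := by
    intro i
    obtain ⟨j, hj, hmin⟩ := Set.exists_min_image {j | (annulusGraph X r₁ r₂).Reachable i j}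
      (fun j => ‖(X j : EuclideanSpace ℝ (Fin (t + 1))) - p‖) (Set.toFinite _) ⟨i, .refl i⟩
    refine ⟨j, hj, ?_⟩
    by_contra! h
    obtain ⟨k, hk, hlt⟩ := hstep j h
    exact absurd hlt (hmin k (hj.trans hk)).not_gt
  obtain ⟨j₀, -⟩ := hdense p (by rw [sub_self, norm_zero]; linarith)
  have : Nonempty (Fin n) := ⟨j₀⟩
  refine ⟨fun i j => ?_⟩
  obtain ⟨i', hi', hi'p⟩ := hnear i
  obtain ⟨j', hj', hj'p⟩ := hnear j
  have h := norm_sub_le_norm_sub_add_norm_sub (X i' : EuclideanSpace ℝ (Fin (t + 1))) p (X j')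
  rw [norm_sub_rev (p : EuclideanSpace ℝ (Fin (t + 1)))] at h
  -- Both ends lie within `4 * ε` of `p`, hence `δ = 8 * ε`; this needs a gap above `18 * ε`, which
  -- `20 * ε` provides.
  exact (hi'.trans (reachable_of_near ht hr₁ hr₂ (δ := 8 * ε) (by linarith) hε.le (by linarith)
    hdense (by linarith) (by linarith))).trans hj'.symm

/-! ### The connectivity scale and the limit. -/

/-- The connectivity scale `(log n / n)^(1/t)`. -/
noncomputable def scale (t n : ℕ) : ℝ := (Real.log n / n) ^ (1 / (t : ℝ))

lemma scale_pow {t : ℕ} (ht : 1 ≤ t) (n : ℕ) : scale t n ^ t = Real.log n / n := by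
  rw [scale, one_div, Real.rpow_inv_natCast_pow (by positivity) (by omega)]

lemma scale_pos {t n : ℕ} (hn : 2 ≤ n) : 0 < scale t n := by
  have h : (1 : ℝ) < n := by exact_mod_cast hn
  exact Real.rpow_pos_of_pos (div_pos (Real.log_pos h) (by linarith)) _

lemma tendsto_scale {t : ℕ} (ht : 1 ≤ t) : Tendsto (scale t) atTop (𝓝[>] 0) := by
  refine tendsto_nhdsWithin_iff.2 ⟨?_, ?_⟩
  · have hpos : 0 < 1 / (t : ℝ) := by positivity
    have h := tendsto_log_div_nat.rpow_const (p := 1 / (t : ℝ)) (Or.inr hpos.le)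
    rwa [Real.zero_rpow hpos.ne'] at h
  · filter_upwards [eventually_ge_atTop 2] with n hn
    exact scale_pos hn

lemma connected_of_occupied_of_closer {t n : ℕ} (ht : 1 ≤ t) {X : Fin n → Sphere t} {p : Sphere t}
    {a b K ε l : ℝ} (hb : 0 ≤ b) (hε : 0 < ε) (hgap : 20 * ε ≤ a - b) (hεK : 4 * ε ≤ K)
    (hl : 0 < l) (hal : a * l ≤ 2) (hKl : K * l ≤ 1 / 4) {Z : Finset (Sphere t)}
    (hZ : ∀ q : Sphere t, dist q p ≤ (K + a) * l → ∃ z ∈ Z, dist q z ≤ ε / 2 * l)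
    (hocc : ¬ ∃ z ∈ Z, ∀ j, X j ∉ Metric.closedBall z (ε / 2 * l))
    (hcloser : ¬ ∃ i, X i ∈ {x : Sphere t | K * l ≤ ‖(x : EuclideanSpace ℝ (Fin (t + 1))) - p‖} ∧
      ∀ j, j ≠ i → X j ∉ closerNbhd p (b * l) (a * l) (X i)) :
    (annulusGraph X (b * l) (a * l)).Connected := by
  push Not at hocc hcloser
  refine connected_annulusGraph ht (p := p) (R := K * l) (ε := ε * l) (by positivity) hal
    (by positivity) (by nlinarith) (by nlinarith) hKl (fun q hq => ?_) hcloser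
  obtain ⟨z, hz, hqz⟩ := hZ q (by
    rw [Subtype.dist_eq, dist_eq_norm, add_mul]
    exact hq)
  obtain ⟨j, hj⟩ := hocc z hz
  refine ⟨j, ?_⟩
  rw [← dist_eq_norm, ← Subtype.dist_eq]
  calc dist q (X j) ≤ dist q z + dist (X j) z := dist_triangle_right _ _ _
    _ ≤ ε / 2 * l + ε / 2 * l := add_le_add hqz hj
    _ = ε * l := by ring

theorem tendsto_probConnected {t : ℕ} (ht : 1 ≤ t) {a b : ℝ} (hb : 0 ≤ b) (hab : b < a)
    (hgap : 8 * psi t ≤ a ^ t - b ^ t) :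
    Tendsto (fun n : ℕ => probConnected t n (b * scale t n) (a * scale t n)) atTop (𝓝 1) := by
  let p : Sphere t := ⟨EuclideanSpace.single 0 1, by simp⟩
  obtain ⟨K₀, hK₀, hclose⟩ := exists_le_uniformSphere_closerNbhd ht hb hab hgap p
  set ε := (a - b) / 20 with hεdef
  have hε : 0 < ε := by linarith
  obtain ⟨c, hc, hcap⟩ := exists_le_uniformSphere_cap ht (half_pos hε)
  -- `K₀` is the drift threshold; the extra `4 * ε` ensures `4 * ε ≤ K`, as the descent near `p`
  -- requires.
  set K := K₀ + 4 * ε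
  have hK : 0 < K := by positivity
  obtain ⟨M, hM⟩ := exists_card_le_cover_cap p (K + a) (half_pos hε)
  have hsmall : ∀ s : ℝ, ∀ r > 0, ∀ᶠ l in 𝓝[>] (0 : ℝ), s * l ≤ r := by
    intro s r hr
    have h : ContinuousAt (fun l : ℝ => s * l) 0 := by fun_prop
    refine nhdsWithin_le_nhds ((h.eventually (gt_mem_nhds ?_)).mono fun _ => le_of_lt)
    simpa using hr
  have hbound : ∀ᶠ n : ℕ in atTop,
      1 - ((M : ℝ≥0∞) * (1 - ENNReal.ofReal (c * (Real.log n / n))) ^ n +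
        n * (1 - ENNReal.ofReal (2 * (Real.log n / n))) ^ (n - 1)) ≤
      probConnected t n (b * scale t n) (a * scale t n) := by
    filter_upwards [(tendsto_scale ht).eventually hclose, (tendsto_scale ht).eventually hcap,
      (tendsto_scale ht).eventually (hsmall a 2 two_pos),
      (tendsto_scale ht).eventually (hsmall K (1 / 4) (by norm_num)), eventually_ge_atTop 2]
      with n h1 h2 h3 h4 hn
    have hl : 0 < scale t n := scale_pos hn
    set l := scale t n with hldef
    rw [hldef, scale_pow ht, ← hldef] at h1 h2
    obtain ⟨Z, hZM, hZ⟩ := hM l hl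
    have hfar : MeasurableSet
        {x : Sphere t | K * l ≤ ‖(x : EuclideanSpace ℝ (Fin (t + 1))) - p‖} :=
      measurableSet_le measurable_const (by fun_prop)
    have hE₁ := pi_exists_forall_notMem_le (uniformSphere t) Z
      (A := fun z => Metric.closedBall z (ε / 2 * l)) (fun _ => measurableSet_closedBall) h2 n
    have hE₂ := pi_exists_isolated_le (uniformSphere t) hfar
      (measurableSet_closerNbhd_prod p (b * l) (a * l)) (fun x hx => h1 x (by
        refine le_trans ?_ hx
        gcongr
        simp only [K]
        linarith)) n
    rw [tsub_le_iff_right]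
    have huniv : positionLaw t n Set.univ = 1 := by
      rw [positionLaw]
      exact measure_univ
    -- The connected event and the two failure events cover the whole space, so subadditivity gives
    -- the bound without measurability of the connected event.
    refine huniv.ge.trans ((measure_mono fun X _ => ?_).trans ((measure_union_le _ _).trans (add_le_add le_rfl
      ((measure_union_le _ _).trans (add_le_add (hE₁.trans (by gcongr)) hE₂)))))
    by_cases hX1 : ∃ z ∈ Z, ∀ j, X j ∉ Metric.closedBall z (ε / 2 * l)
    · exact Or.inr (Or.inl hX1)
    by_cases hX2 : ∃ i, X i ∈ {x : Sphere t | K * l ≤ ‖(x : EuclideanSpace ℝ (Fin (t + 1))) - p‖} ∧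
        ∀ j, j ≠ i → X j ∉ closerNbhd p (b * l) (a * l) (X i)
    · exact Or.inr (Or.inr hX2)
    · exact Or.inl (connected_of_occupied_of_closer ht hb hε (by linarith)
        (by simp only [K]; linarith) hl h3 h4 hZ hX1 hX2)
  have hlim := ENNReal.Tendsto.sub tendsto_const_nhds
    ((tendsto_const_mul_one_sub_pow M hc).add tendsto_mul_one_sub_pow_pred)
    (Or.inl ENNReal.one_ne_top)
  rw [add_zero, tsub_zero] at hlim
  refine tendsto_of_tendsto_of_tendsto_of_le_of_le' hlim tendsto_const_nhds hbound
    (Eventually.of_forall fun n => ?_)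
  have : IsProbabilityMeasure (positionLaw t n) := by
    rw [positionLaw]
    infer_instance
  exact prob_le_one

/-- As `2^(1 + 1/t) > 2`, the denominator lies in `(0, 1)`, so dividing by it increases the left
side; the factor `t + 1` is at least 1. -/
lemma eight_psi_le_of_gap {t : ℕ} {x : ℝ} (ht : 1 ≤ t)
    (h : 8 * ((t : ℝ) + 1) * psi t / (1 - 1 / ((2 : ℝ) ^ (1 + 1 / (t : ℝ)) - 1)) ≤ x) :
    8 * psi t ≤ x := by
  have hψ := psi_pos t
  have htpos : 0 < 1 / (t : ℝ) := by positivity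
  have h2 : (2 : ℝ) < 2 ^ (1 + 1 / (t : ℝ)) :=
    Real.self_lt_rpow_of_one_lt one_lt_two (by linarith)
  have hinv : 1 / ((2 : ℝ) ^ (1 + 1 / (t : ℝ)) - 1) < 1 := by
    rw [div_lt_one (by linarith)]
    linarith
  have hinv0 : 0 < 1 / ((2 : ℝ) ^ (1 + 1 / (t : ℝ)) - 1) := div_pos one_pos (by linarith)
  refine le_trans ?_ h
  rw [le_div_iff₀ (by linarith)]
  have ht1 : (1 : ℝ) ≤ t := by exact_mod_cast ht
  calc 8 * psi t * (1 - 1 / ((2 : ℝ) ^ (1 + 1 / (t : ℝ)) - 1)) ≤ 8 * psi t * ((t : ℝ) + 1) := by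
        gcongr
        linarith
    _ = 8 * ((t : ℝ) + 1) * psi t := by ring

end RAG

theorem theorem3 (t : ℕ) (ht : 1 ≤ t) (a b : ℝ) (hb : 0 ≤ b)
    (hgap : 8 * ((t : ℝ) + 1) * RAG.psi t /
        (1 - 1 / ((2 : ℝ) ^ (1 + 1 / (t : ℝ)) - 1)) ≤ a ^ t - b ^ t)
    (hab : (2 : ℝ) ^ (1 + 1 / (t : ℝ)) * b < a) :
    Tendsto
      (fun n : ℕ => RAG.probConnected t n
        (b * (Real.log n / n) ^ (1 / (t : ℝ)))
        (a * (Real.log n / n) ^ (1 / (t : ℝ))))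
      atTop (𝓝 1) := by
  refine RAG.tendsto_probConnected ht hb (lt_of_le_of_lt ?_ hab) (RAG.eight_psi_le_of_gap ht hgap)
  have h : (1 : ℝ) ≤ 2 ^ (1 + 1 / (t : ℝ)) := Real.one_le_rpow one_le_two (by positivity)
  exact le_mul_of_one_le_left hb h
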